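/- Let $(\Omega,\mathcal F,\mathbb P)$ be a probability space and $\mathcal X$ an arbitrary measurable space. Let $Y$ be a real, $X$ an $\mathcal X$-valued, $p$ a $[0,1]$-valued and $G$ a (latent) $\{0,1\}$-valued random variable, and let $m(x)=\mathbb E[Y\mid X=x]$, $r(x)=\mathbb E[p\mid X=x]$ be (measurable versions of) the conditional mean functions. Assume: 1. there are a measurable $\mu:\mathcal X\to\mathbb R$ and $\tau\in\mathbb R$ with $\mathbb E[Y\mid G,p,X]=\mu(X)+\tau G$ a.s.; 2. $\mathbb E[G\mid p,X]=p$ a.s.; 3. $V^*:=\mathbb E[(p-r(X))^2]>0$; 4. $\mathbb E[Y^4]<\infty$ and $\mathbb E[p^4]<\infty$. Let $(Y_i,X_i,p_i)$, $i\ge 1$, be i.i.d. draws from the joint law of $(Y,X,p)$. Put $$\hat\tau_{\mathrm{or}}=\frac{\frac1n\sum_{i\le n}(2p_i-1)(Y_i-m(X_i))}{2\,\frac1n\sum_{i\le n}(p_i-r(X_i))^2},\qquad \hat\psi_i=(2p_i-1)(Y_i-m(X_i))-2\hat\tau_{\mathrm{or}}(p_i-r(X_i))^2,$$ $$\hat\sigma^2_{\mathrm{or}}=\frac{\frac1n\sum_{i\le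 n}\hat\psi_i^2}{\bigl(2\,\frac1n\sum_{i\le n}(p_i-r(X_i))^2\bigr)^2},\qquad \psi=(2p-1)(Y-m(X))-2\tau(p-r(X))^2,\qquad \sigma^2_{\mathrm{or}}=\frac{\mathbb E[\psi^2]}{(2V^*)^2}.$$ Then $\mathbb E[\psi^2]<\infty$ and $\hat\sigma^2_{\mathrm{or}}\to\sigma^2_{\mathrm{or}}$ in probability as $n\to\infty$. If moreover $\sigma^2_{\mathrm{or}}>0$, then for every $\alpha\in(0,1)$, with $z_{1-\alpha/2}$ the $(1-\alpha/2)$-quantile of the standard normal distribution, the Wald interval has asymptotic coverage $1-\alpha$: $$\lim_{n\to\infty}\mathbb P\bigl(\hat\tau_{\mathrm{or}}-z_{1-\alpha/2}\hat\sigma_{\mathrm{or}}/\sqrt n\le\tau\le\hat\tau_{\mathrm{or}}+z_{1-\alpha/2}\hat\sigma_{\mathrm{or}}/\sqrt n\bigr)=1-\alpha .$$ -/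

import Mathlib

open MeasureTheory ProbabilityTheory Filter Topology

noncomputable section

namespace LatentGroup

section Model

variable {Ω 𝒳 : Type*} [MeasurableSpace Ω] [MeasurableSpace 𝒳]

/-- `f` is (a version of) the conditional mean function `x ↦ E[Z ∣ X = x]`. -/
structure IsCondMeanFun (P : Measure Ω) (Z : Ω → ℝ) (X : Ω → 𝒳) (f : 𝒳 → ℝ) : Prop where
  measurable : Measurable f
  integrable : Integrable Z P
  ae_eq : P[Z | MeasurableSpace.comap X inferInstance] =ᵐ[P] fun ω => f (X ω)

/-- The basic setting: `Y` real, `X` with values in the covariate space, the score `p` with values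
in `[0,1]`, and the latent binary indicator `G`. -/
structure IsSetting (Y : Ω → ℝ) (X : Ω → 𝒳) (p G : Ω → ℝ) : Prop where
  measurable_Y : Measurable Y
  measurable_X : Measurable X
  measurable_p : Measurable p
  measurable_G : Measurable G
  p_mem : ∀ ω, p ω ∈ Set.Icc (0 : ℝ) 1
  G_binary : ∀ ω, G ω = 0 ∨ G ω = 1

/-- Structural conditional mean with coefficient `τ`: there is a measurable `μ` with
`E[Y ∣ G, p, X] = μ(X) + τ G` a.s. -/
def StructuralMean (P : Measure Ω) (Y : Ω → ℝ) (X : Ω → 𝒳) (p G : Ω → ℝ) (τ : ℝ) : Prop :=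
  ∃ μ : 𝒳 → ℝ, Measurable μ ∧
    P[Y | MeasurableSpace.comap (fun ω => (G ω, p ω, X ω)) inferInstance]
      =ᵐ[P] fun ω => μ (X ω) + τ * G ω

/-- Conditional calibration: `E[G ∣ p, X] = p` a.s. -/
def Calibrated (P : Measure Ω) (X : Ω → 𝒳) (p G : Ω → ℝ) : Prop :=
  P[G | MeasurableSpace.comap (fun ω => (p ω, X ω)) inferInstance] =ᵐ[P] p

/-- Residual score variance `V* = E[(p - r(X))²]`. -/
def residualVar (P : Measure Ω) (X : Ω → 𝒳) (p : Ω → ℝ) (r : 𝒳 → ℝ) : ℝ :=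
  ∫ ω, (p ω - r (X ω)) ^ 2 ∂P

/-- The score `(2p - 1)(y - m(x)) - 2 t (p - r(x))²` of one observation `(y, x, p)` at `t`. -/
def score (m r : 𝒳 → ℝ) (t y : ℝ) (x : 𝒳) (p : ℝ) : ℝ :=
  (2 * p - 1) * (y - m x) - 2 * t * (p - r x) ^ 2

/-- Asymptotic variance `σ²_or = E[ψ²] / (2 V*)²`, where `ψ` is the score at `τ`. -/
def sigmaSq (P : Measure Ω) (Y : Ω → ℝ) (X : Ω → 𝒳) (p : Ω → ℝ) (m r : 𝒳 → ℝ) (τ : ℝ) : ℝ :=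
  (∫ ω, score m r τ (Y ω) (X ω) (p ω) ^ 2 ∂P) / (2 * residualVar P X p r) ^ 2

/-- `(Ys i, Xs i, ps i)`, `i = 0, 1, 2, …`, are i.i.d. draws from the joint law of `(Y, X, p)`. -/
structure IsIIDSample (P : Measure Ω) (Y : Ω → ℝ) (X : Ω → 𝒳) (p : Ω → ℝ)
    (Ys : ℕ → Ω → ℝ) (Xs : ℕ → Ω → 𝒳) (ps : ℕ → Ω → ℝ) : Prop where
  measurable_Y : ∀ i, Measurable (Ys i)
  measurable_X : ∀ i, Measurable (Xs i)
  measurable_p : ∀ i, Measurable (ps i)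
  indep : iIndepFun (fun i ω => (Ys i ω, Xs i ω, ps i ω)) P
  ident : ∀ i, IdentDistrib (fun ω => (Ys i ω, Xs i ω, ps i ω)) (fun ω => (Y ω, X ω, p ω)) P P

/-- The sample mean `n⁻¹ ∑_{i<n} Z i` of the first `n` terms. -/
def sampleMean (Z : ℕ → ℝ) (n : ℕ) : ℝ :=
  (1 / (n : ℝ)) * ∑ i ∈ Finset.range n, Z i

/-- Oracle estimator computed from the first `n` observations. -/
def tauHat (m r : 𝒳 → ℝ) (Ys : ℕ → Ω → ℝ) (Xs : ℕ → Ω → 𝒳) (ps : ℕ → Ω → ℝ)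
    (n : ℕ) (ω : Ω) : ℝ :=
  sampleMean (fun i => (2 * ps i ω - 1) * (Ys i ω - m (Xs i ω))) n /
    (2 * sampleMean (fun i => (ps i ω - r (Xs i ω)) ^ 2) n)

/-- Estimated score `ψ̂_i` of observation `i` in the sample of size `n`. -/
def psiHat (m r : 𝒳 → ℝ) (Ys : ℕ → Ω → ℝ) (Xs : ℕ → Ω → 𝒳) (ps : ℕ → Ω → ℝ)
    (n i : ℕ) (ω : Ω) : ℝ :=
  score m r (tauHat m r Ys Xs ps n ω) (Ys i ω) (Xs i ω) (ps i ω)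

/-- Plug-in sandwich variance estimator computed from the first `n` observations. -/
def sigmaSqHat (m r : 𝒳 → ℝ) (Ys : ℕ → Ω → ℝ) (Xs : ℕ → Ω → 𝒳) (ps : ℕ → Ω → ℝ)
    (n : ℕ) (ω : Ω) : ℝ :=
  sampleMean (fun i => psiHat m r Ys Xs ps n i ω ^ 2) n /
    (2 * sampleMean (fun i => (ps i ω - r (Xs i ω)) ^ 2) n) ^ 2

/-- The `q`-quantile of the standard normal distribution. -/
def normalQuantile (q : ℝ) : ℝ :=
  sInf {x : ℝ | q ≤ cdf (gaussianReal 0 1) x}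

/-- Wald interval `τ̂ ± z_{1-α/2} σ̂ / √n`. -/
def waldInterval (m r : 𝒳 → ℝ) (Ys : ℕ → Ω → ℝ) (Xs : ℕ → Ω → 𝒳) (ps : ℕ → Ω → ℝ)
    (α : ℝ) (n : ℕ) (ω : Ω) : Set ℝ :=
  Set.Icc
    (tauHat m r Ys Xs ps n ω
      - normalQuantile (1 - α / 2) * √(sigmaSqHat m r Ys Xs ps n ω) / √(n : ℝ))
    (tauHat m r Ys Xs ps n ω
      + normalQuantile (1 - α / 2) * √(sigmaSqHat m r Ys Xs ps n ω) / √(n : ℝ))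

end Model

end LatentGroup

end

noncomputable section

namespace LatentGroup

/-! ### Population moments -/

section Population

/-! By calibration and the tower property `E[Y ∣ p, X] = μ(X) + τ p`. Conditioning once more on `X`
gives `m = μ + τ r` at `X`, so `μ` cancels and `E[Y - m(X) ∣ p, X] = τ (p - r(X))`. Since `p - r(X)`
is orthogonal to functions of `X`, this yields `E[d] = 2 τ E[q]` with `d = (2p-1)(Y-m(X))` and `q =
(p-r(X))²` (`integral_numerator`).

The rest concerns a ratio estimator with square-integrable `d`, `q` and `E[q] > 0`. The strong law
gives consistency of the ratio and of the plug-in second moment (`ae_tendsto_ratioMoment`). For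
coverage no delta method is needed: once the sample mean of `q` is positive, the denominator cancels
and `τ` lies in the interval iff the standardized sum of the true scores is at most `z` times a
factor tending to 1 (`mem_ratio_interval_iff`). The CLT and Slutsky finish the proof. -/

lemma integral_mul_eq_of_condExp {Ω : Type*} {ℳ m0 : MeasurableSpace Ω} {P : Measure[m0] Ω}
    [IsFiniteMeasure P] (hℳ : ℳ ≤ m0) {f g h : Ω → ℝ} (hf : StronglyMeasurable[ℳ] f)
    (hfg : Integrable (fun ω => f ω * g ω) P) (hg : Integrable g P) (hgh : P[g | ℳ] =ᵐ[P] h) :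
    ∫ ω, f ω * g ω ∂P = ∫ ω, f ω * h ω ∂P := by
  have h1 := condExp_mul_of_stronglyMeasurable_left hf hfg hg
  rw [← integral_condExp (f := fun ω => f ω * g ω) hℳ]
  refine integral_congr_ae ?_
  filter_upwards [h1, hgh] with ω h1 h2
  change (P[f * g | ℳ]) ω = _
  rw [h1, Pi.mul_apply, h2]

lemma memLp_four_of_integrable_pow {Ω : Type*} [MeasurableSpace Ω] {P : Measure Ω} {Z : Ω → ℝ}
    (hZ : Measurable Z)    (h : Integrable (fun ω => Z ω ^ 4) P) : MemLp Z 4 P := by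
  rw [← integrable_norm_rpow_iff hZ.aestronglyMeasurable (by norm_num) (by simp)]
  refine h.congr (ae_of_all _ fun ω => ?_)
  simp [Real.norm_eq_abs, Even.pow_abs (by decide : Even 4)]

lemma comap_le_comap_prodMk {Ω α β : Type*} [MeasurableSpace α] [MeasurableSpace β] (f : Ω → α)
    (g : Ω → β) : MeasurableSpace.comap g inferInstance
      ≤ MeasurableSpace.comap (fun ω => (f ω, g ω)) inferInstance :=
  Measurable.comap_le (measurable_snd.comp (comap_measurable (fun ω => (f ω, g ω))))

variable {Ω 𝒳 : Type*} [MeasurableSpace Ω] [MeasurableSpace 𝒳] {P : Measure Ω}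
  {Y : Ω → ℝ} {X : Ω → 𝒳} {p G : Ω → ℝ} {τ : ℝ} {m r : 𝒳 → ℝ}

/-- Conditional expectation is a contraction of every `L^q`, `q ≥ 1`. -/
lemma IsCondMeanFun.memLp {Z : Ω → ℝ} {f : 𝒳 → ℝ} {q : ENNReal} (hf : IsCondMeanFun P Z X f)
    (hq : 1 ≤ q) (hZ : MemLp Z q P) : MemLp (fun ω => f (X ω)) q P :=
  (hZ.condExp hq).ae_eq hf.ae_eq

variable [IsProbabilityMeasure P]

lemma IsSetting.memLp_p (hset : IsSetting Y X p G) (q : ENNReal) : MemLp p q P :=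
  MemLp.of_bound hset.measurable_p.aestronglyMeasurable 1 (ae_of_all _ fun ω => by
    rw [Real.norm_eq_abs, abs_le]; exact ⟨by linarith [(hset.p_mem ω).1], (hset.p_mem ω).2⟩)

lemma IsSetting.integrable_G (hset : IsSetting Y X p G) : Integrable G P :=
  Integrable.of_bound hset.measurable_G.aestronglyMeasurable 1 (ae_of_all _ fun ω => by
    rcases hset.G_binary ω with h | h <;> simp [h])

lemma IsSetting.memLp_residual (hset : IsSetting Y X p G) (hr : IsCondMeanFun P p X r)
    (q : ENNReal) : MemLp (fun ω => p ω - r (X ω)) q P :=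
  ((hset.memLp_p ⊤).sub (hr.memLp le_top (hset.memLp_p ⊤))).mono_exponent le_top

lemma exists_condExp_outcome (hset : IsSetting Y X p G)
    (hmean : StructuralMean P Y X p G τ) (hcal : Calibrated P X p G) :
    ∃ μ : 𝒳 → ℝ, Measurable μ ∧ Integrable (fun ω => μ (X ω)) P ∧
      P[Y | MeasurableSpace.comap (fun ω => (p ω, X ω)) inferInstance]
        =ᵐ[P] fun ω => μ (X ω) + τ * p ω := by
  obtain ⟨μ, hμ, h⟩ := hmean
  have hG : Integrable G P := hset.integrable_G
  -- Integrability of `μ(X)` is not assumed; it follows because `μ(X)` is a conditional expectation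
  -- minus the bounded `τ G`.
  have hμi : Integrable (fun ω => μ (X ω)) P := by
    refine ((integrable_condExp (μ := P) (f := Y)
      (m := MeasurableSpace.comap (fun ω => (G ω, p ω, X ω)) inferInstance)).sub (hG.const_mul τ)).congr ?_
    filter_upwards [h] with ω hω
    simp [hω]
  refine ⟨μ, hμ, hμi, ?_⟩
  have hle := comap_le_comap_prodMk G (fun ω => (p ω, X ω))
  have hpX : Measurable (fun ω => (p ω, X ω)) := hset.measurable_p.prodMk hset.measurable_X
  have hle' : MeasurableSpace.comap (fun ω => (G ω, p ω, X ω)) inferInstance ≤ _ :=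
    (hset.measurable_G.prodMk hpX).comap_le
  have hsm : StronglyMeasurable[MeasurableSpace.comap (fun ω => (p ω, X ω)) inferInstance]
      (fun ω => μ (X ω)) :=
    ((hμ.comp measurable_snd).comp (comap_measurable (fun ω => (p ω, X ω)))).stronglyMeasurable
  have h1 := (condExp_condExp_of_le (f := Y) (μ := P) hle hle').symm.trans
    (condExp_congr_ae h)
  have h2 := condExp_add (m := MeasurableSpace.comap (fun ω => (p ω, X ω)) inferInstance)
    hμi (hG.const_mul τ)
  have h3 := condExp_smul (μ := P) τ G (MeasurableSpace.comap (fun ω => (p ω, X ω)) inferInstance)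
  rw [condExp_of_stronglyMeasurable hpX.comap_le hsm hμi] at h2
  filter_upwards [h1, h2, h3, hcal] with ω h1 h2 h3 h4
  rw [h1]
  refine h2.trans ?_
  rw [Pi.add_apply]
  congr 1
  refine h3.trans ?_
  rw [Pi.smul_apply, h4, smul_eq_mul]

lemma condMean_eq (hset : IsSetting Y X p G) (hm : IsCondMeanFun P Y X m)
    (hr : IsCondMeanFun P p X r) {μ : 𝒳 → ℝ} (hμ : Measurable μ)
    (hμi : Integrable (fun ω => μ (X ω)) P)
    (h : P[Y | MeasurableSpace.comap (fun ω => (p ω, X ω)) inferInstance]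
        =ᵐ[P] fun ω => μ (X ω) + τ * p ω) :
    ∀ᵐ ω ∂P, m (X ω) = μ (X ω) + τ * r (X ω) := by
  have hpX : Measurable (fun ω => (p ω, X ω)) := hset.measurable_p.prodMk hset.measurable_X
  have hsm : StronglyMeasurable[MeasurableSpace.comap X inferInstance] (fun ω => μ (X ω)) :=
    (hμ.comp (comap_measurable X)).stronglyMeasurable
  have h1 := (condExp_condExp_of_le (f := Y) (μ := P) (comap_le_comap_prodMk p X)
    hpX.comap_le).symm.trans (condExp_congr_ae h)
  have h2 := condExp_add (m := MeasurableSpace.comap X inferInstance)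
    hμi (hr.integrable.const_mul τ)
  have h3 := condExp_smul (μ := P) τ p (MeasurableSpace.comap X inferInstance)
  rw [condExp_of_stronglyMeasurable hset.measurable_X.comap_le hsm hμi] at h2
  filter_upwards [h1, h2, h3, hm.ae_eq, hr.ae_eq] with ω h1 h2 h3 h4 h5
  rw [← h4, h1]
  refine h2.trans ?_
  rw [Pi.add_apply]
  congr 1
  refine h3.trans ?_
  rw [Pi.smul_apply, h5, smul_eq_mul]

lemma condExp_outcome_residual (hset : IsSetting Y X p G) (hm : IsCondMeanFun P Y X m)
    (hr : IsCondMeanFun P p X r) (hmean : StructuralMean P Y X p G τ)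
    (hcal : Calibrated P X p G) (hmi : Integrable (fun ω => m (X ω)) P) :
    P[fun ω => Y ω - m (X ω) | MeasurableSpace.comap (fun ω => (p ω, X ω)) inferInstance]
      =ᵐ[P] fun ω => τ * (p ω - r (X ω)) := by
  obtain ⟨μ, hμ, hμi, h⟩ := exists_condExp_outcome hset hmean hcal
  have hpX : Measurable (fun ω => (p ω, X ω)) := hset.measurable_p.prodMk hset.measurable_X
  have hsm : StronglyMeasurable[MeasurableSpace.comap (fun ω => (p ω, X ω)) inferInstance]
      (fun ω => m (X ω)) :=
    ((hm.measurable.comp measurable_snd).comp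
      (comap_measurable (fun ω => (p ω, X ω)))).stronglyMeasurable
  have h2 := condExp_sub hm.integrable hmi
    (MeasurableSpace.comap (fun ω => (p ω, X ω)) inferInstance)
  rw [condExp_of_stronglyMeasurable hpX.comap_le hsm hmi] at h2
  filter_upwards [h, h2, condMean_eq hset hm hr hμ hμi h] with ω h1 h2 h3
  refine h2.trans ?_
  rw [Pi.sub_apply, h1, h3]
  ring

lemma condExp_score_residual (hset : IsSetting Y X p G) (hr : IsCondMeanFun P p X r) :
    P[fun ω => p ω - r (X ω) | MeasurableSpace.comap X inferInstance] =ᵐ[P] 0 := by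
  have hri : Integrable (fun ω => r (X ω)) P := integrable_condExp.congr hr.ae_eq
  have hsm : StronglyMeasurable[MeasurableSpace.comap X inferInstance] (fun ω => r (X ω)) :=
    (hr.measurable.comp (comap_measurable X)).stronglyMeasurable
  have h2 := condExp_sub hr.integrable hri (MeasurableSpace.comap X inferInstance)
  rw [condExp_of_stronglyMeasurable hset.measurable_X.comap_le hsm hri] at h2
  filter_upwards [hr.ae_eq, h2] with ω h1 h2
  refine h2.trans ?_
  simp [h1]

lemma memLp_numerator (hset : IsSetting Y X p G) (hm : IsCondMeanFun P Y X m)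
    (hY4 : Integrable (fun ω => Y ω ^ 4) P) :
    MemLp (fun ω => (2 * p ω - 1) * (Y ω - m (X ω))) 4 P := by
  have hY : MemLp Y 4 P := memLp_four_of_integrable_pow hset.measurable_Y hY4
  have hd : MemLp (fun ω => Y ω - m (X ω)) 4 P := hY.sub (hm.memLp (by norm_num) hY)
  have h1 : MemLp (fun ω => 2 * p ω - 1) ⊤ P := ((hset.memLp_p ⊤).const_mul 2).sub (memLp_const 1)
  exact hd.mul h1

/-- The moment identity `E[(2p - 1)(Y - m(X))] = 2 τ V*`. -/
lemma integral_numerator (hset : IsSetting Y X p G) (hm : IsCondMeanFun P Y X m)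
    (hr : IsCondMeanFun P p X r) (hmean : StructuralMean P Y X p G τ)
    (hcal : Calibrated P X p G) (hY4 : Integrable (fun ω => Y ω ^ 4) P) :
    ∫ ω, (2 * p ω - 1) * (Y ω - m (X ω)) ∂P = 2 * τ * residualVar P X p r := by
  have hmi : Integrable (fun ω => m (X ω)) P := integrable_condExp.congr hm.ae_eq
  have hpX : Measurable (fun ω => (p ω, X ω)) := hset.measurable_p.prodMk hset.measurable_X
  have hres : MemLp (fun ω => p ω - r (X ω)) 2 P := hset.memLp_residual hr 2
  have hr2 : MemLp (fun ω => r (X ω)) ⊤ P := hr.memLp le_top (hset.memLp_p ⊤)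
  have hf : StronglyMeasurable[MeasurableSpace.comap (fun ω => (p ω, X ω)) inferInstance]
      (fun ω => 2 * p ω - 1) :=
    (((measurable_fst.const_mul (2 : ℝ)).sub_const 1).comp
      (comap_measurable (fun ω => (p ω, X ω)))).stronglyMeasurable
  have hg : StronglyMeasurable[MeasurableSpace.comap X inferInstance]
      (fun ω => 2 * r (X ω) - 1) :=
    (((hr.measurable.const_mul 2).sub_const 1).comp (comap_measurable X)).stronglyMeasurable
  have hgi : Integrable (fun ω => (2 * r (X ω) - 1) * (p ω - r (X ω))) P :=
    MemLp.integrable_mul (p := 2) (q := 2)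
      (((hr2.mono_exponent le_top).const_mul 2).sub (memLp_const 1)) hres
  have hfi : Integrable (fun ω => (2 * p ω - 1) * (Y ω - m (X ω))) P :=
    (memLp_numerator hset hm hY4).integrable (by norm_num)
  rw [integral_mul_eq_of_condExp hpX.comap_le hf hfi (hm.integrable.sub hmi)
    (condExp_outcome_residual hset hm hr hmean hcal hmi)]
  have h0 := integral_mul_eq_of_condExp hset.measurable_X.comap_le hg hgi
    (hres.integrable (by norm_num)) (condExp_score_residual hset hr)
  simp only [Pi.zero_apply, mul_zero, integral_zero] at h0
  have hsq := hres.integrable_sq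
  -- Split `2p - 1 = 2(p - r) + (2r - 1)`; the second part is a function of `X`, hence orthogonal to
  -- `p - r(X)`.
  calc ∫ ω, (2 * p ω - 1) * (τ * (p ω - r (X ω))) ∂P
      = ∫ ω, (2 * τ * (p ω - r (X ω)) ^ 2
          + τ * ((2 * r (X ω) - 1) * (p ω - r (X ω)))) ∂P := by
        congr 1; ext ω; ring
    _ = _ := by
        rw [integral_add (hsq.const_mul _) (hgi.const_mul _), integral_const_mul,
          integral_const_mul, h0, residualVar, mul_zero, add_zero]

lemma memLp_denominator (hset : IsSetting Y X p G) (hr : IsCondMeanFun P p X r) (q : ENNReal) :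
    MemLp (fun ω => (p ω - r (X ω)) ^ 2) q P := by
  have h := hset.memLp_residual hr ⊤ (P := P)
  have := MemLp.mul (r := ⊤) h h
  simp only [pow_two]
  exact this.mono_exponent le_top

end Population

/-! ### The standard normal quantile -/

section Quantile

lemma continuous_cdf {ν : Measure ℝ} [IsProbabilityMeasure ν] [NullSingletonClass ν] :
    Continuous (cdf ν) := by
  rw [continuous_iff_continuousAt]
  intro x
  rw [(monotone_cdf ν).continuousAt_iff_leftLim_eq_rightLim, StieltjesFunction.rightLim_eq]
  have h : (cdf ν).measure {x} = 0 := by rw [measure_cdf]; exact measure_singleton x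
  -- The jump of the cdf at `x` is the mass of `{x}`, which is zero.
  rw [StieltjesFunction.measure_singleton, ENNReal.ofReal_eq_zero] at h
  exact le_antisymm ((monotone_cdf ν).leftLim_le le_rfl) (by linarith)

lemma cdf_normalQuantile {q : ℝ} (h0 : 0 < q) (h1 : q < 1) :
    cdf (gaussianReal 0 1) (normalQuantile q) = q := by
  have : NullSingletonClass (gaussianReal 0 1) := nullSingletonClass_gaussianReal one_ne_zero
  set F := cdf (gaussianReal 0 1)
  have hc : Continuous F := continuous_cdf
  obtain ⟨a, ha⟩ := ((tendsto_cdf_atBot (gaussianReal 0 1)).eventually_lt_const h0).exists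
  obtain ⟨b, hb⟩ := ((tendsto_cdf_atTop (gaussianReal 0 1)).eventually_const_lt h1).exists
  have hne : {x : ℝ | q ≤ F x}.Nonempty := ⟨b, hb.le⟩
  have hbdd : BddBelow {x : ℝ | q ≤ F x} := ⟨a, fun x hx => le_of_lt <|
    (monotone_cdf (gaussianReal 0 1)).reflect_lt (lt_of_lt_of_le ha hx)⟩
  have hcl : IsClosed {x : ℝ | q ≤ F x} := isClosed_le continuous_const hc
  refine le_antisymm ?_ (hcl.csInf_mem hne hbdd)
  -- To the left of the infimum the cdf is below `q`; continuity carries the bound to the infimum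
  -- itself.
  refine le_of_tendsto (hc.continuousWithinAt (s := Set.Iio (normalQuantile q))) ?_
  filter_upwards [self_mem_nhdsWithin] with x hx
  by_contra! hlt
  exact absurd (csInf_le hbdd hlt.le) (not_le.2 hx)

lemma gaussianReal_Icc_normalQuantile {α : ℝ} (h0 : 0 < α) (h1 : α < 1) :
    (gaussianReal 0 1).real (Set.Icc (-normalQuantile (1 - α / 2)) (normalQuantile (1 - α / 2)))
      = 1 - α := by
  have : NullSingletonClass (gaussianReal 0 1) := nullSingletonClass_gaussianReal one_ne_zero
  set z := normalQuantile (1 - α / 2)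
  have hz : (gaussianReal 0 1).real (Set.Iic z) = 1 - α / 2 := by
    rw [← cdf_eq_real]; exact cdf_normalQuantile (by linarith) (by linarith)
  have hneg : (gaussianReal 0 1).real (Set.Iic (-z)) = α / 2 := by
    have hmap : (gaussianReal 0 1).map (fun x : ℝ => -x) = gaussianReal 0 1 := by
      rw [gaussianReal_map_neg, neg_zero]
    have h : (gaussianReal 0 1).real (Set.Iic (-z)) = (gaussianReal 0 1).real (Set.Ioi z)  := by
      conv_lhs => rw [← hmap, map_measureReal_apply measurable_neg measurableSet_Iic]
      have : (fun x : ℝ => -x) ⁻¹' Set.Iic (-z) = Set.Ici z := by ext; simp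
      rw [this, measureReal_congr Ioi_ae_eq_Ici]
    rw [h, ← Set.compl_Iic, probReal_compl_eq_one_sub measurableSet_Iic, hz]
    ring
  -- Otherwise monotonicity would give `1 - α/2 ≤ α/2`, against `α < 1`.
  have hzz : -z ≤ z := by
    by_contra! hlt
    have := measureReal_mono (μ := gaussianReal 0 1) (Set.Iic_subset_Iic.2 hlt.le)
    linarith
  rw [← measureReal_congr (Ioc_ae_eq_Icc (μ := gaussianReal 0 1)), ← Set.Iic_sdiff_Iic,
    measureReal_sdiff (Set.Iic_subset_Iic.2 hzz) measurableSet_Iic, hz, hneg]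
  ring

end Quantile

/-! ### Ratio estimators from i.i.d. data -/

section Ratio

variable {Ω E : Type*} [MeasurableSpace Ω] [MeasurableSpace E]
  {P : Measure Ω} {Z : Ω → E} {Zs : ℕ → Ω → E}

lemma ae_tendsto_sampleMean (hindep : iIndepFun Zs P) (hident : ∀ i, IdentDistrib (Zs i) Z P P)
    {f : E → ℝ} (hf : Measurable f) (hfi : Integrable (fun ω => f (Z ω)) P) :
    ∀ᵐ ω ∂P, Tendsto (fun n => sampleMean (fun i => f (Zs i ω)) n) atTop
      (𝓝 (∫ ω, f (Z ω) ∂P)) := by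
  have hid (i : ℕ) : IdentDistrib (fun ω => f (Zs i ω)) (fun ω => f (Z ω)) P P :=
    (hident i).comp hf
  have h := strong_law_ae_real (μ := P) (fun i ω => f (Zs i ω)) ((hid 0).integrable_iff.2 hfi)
    (fun i j hij => (hindep.indepFun hij).comp hf hf) (fun i => (hid i).trans (hid 0).symm)
  filter_upwards [h] with ω hω
  rw [(hid 0).integral_eq] at hω
  simpa only [sampleMean, one_div_mul_eq_div] using hω

variable [IsProbabilityMeasure P]

/-- Square integrability is implicit in `hv`: a nonintegrable `f²` would have Bochner integral zero.
-/
lemma tendstoInDistribution_sum_div {f : E → ℝ} (hindep : iIndepFun Zs P)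
    (hident : ∀ i, IdentDistrib (Zs i) Z P P) (hf : Measurable f)
    (h0 : ∫ ω, f (Z ω) ∂P = 0) (hv : 0 < ∫ ω, f (Z ω) ^ 2 ∂P) :
    TendstoInDistribution (fun (n : ℕ) ω => (√(n : ℝ))⁻¹ * ∑ i ∈ Finset.range n,
      f (Zs i ω) / √(∫ ω, f (Z ω) ^ 2 ∂P)) atTop (id : ℝ → ℝ) (fun _ => P) (gaussianReal 0 1) := by
  set v := ∫ ω, f (Z ω) ^ 2 ∂P
  have hfv : Measurable (fun x => f x / √v) := hf.div_const _
  have hid (i : ℕ) : IdentDistrib (fun ω => f (Zs i ω) / √v) (fun ω => f (Z ω) / √v) P P :=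
    (hident i).comp hfv
  refine tendstoInDistribution_inv_sqrt_mul_sum (X := fun i ω => f (Zs i ω) / √v) HasLaw.id ?_ ?_
    (hindep.comp (fun _ => fun x => f x / √v) fun _ => hfv)
    (fun i => (hid i).trans (hid 0).symm)
  · rw [(hid 0).integral_eq, integral_div, h0, zero_div]
  · have := ((hid 0).comp (u := fun x => x ^ 2) (by fun_prop)).integral_eq
    refine this.trans ?_
    simp only [Function.comp_def, div_pow, Real.sq_sqrt hv.le]
    rw [integral_div, div_self hv.ne']

/-- Indicators of the symmetric differences vanish eventually almost surely, so by dominated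
convergence their probabilities tend to zero. This absorbs the samples where a denominator is still
zero. -/
lemma tendsto_measureReal_of_ae_eventually_iff {A B : ℕ → Set Ω} {c : ℝ}
    (hA : ∀ n, MeasurableSet (A n)) (hB : ∀ n, MeasurableSet (B n))
    (hAB : ∀ᵐ ω ∂P, ∀ᶠ n in atTop, ω ∈ A n ↔ ω ∈ B n)
    (h : Tendsto (fun n => P.real (B n)) atTop (𝓝 c)) :
    Tendsto (fun n => P.real (A n)) atTop (𝓝 c) := by
  have h0 : Tendsto (fun n => P (symmDiff (A n) (B n))) atTop (𝓝 (P ∅)) := by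
    refine tendsto_measure_of_ae_tendsto_indicator_of_isFiniteMeasure _ MeasurableSet.empty
      (fun n => (hA n).symmDiff (hB n)) ?_
    filter_upwards [hAB] with ω hω
    filter_upwards [hω] with n hn
    simp [Set.mem_symmDiff, hn]
  rw [measure_empty] at h0
  have h1 : Tendsto (fun n => P.real (symmDiff (A n) (B n))) atTop (𝓝 0) := by
    simpa [Measure.real, Function.comp_def] using (ENNReal.tendsto_toReal ENNReal.zero_ne_top).comp h0
  have h2 : Tendsto (fun n => P.real (A n) - P.real (B n)) atTop (𝓝 0) :=
    squeeze_zero_norm (fun n => abs_measureReal_sub_le_measureReal_symmDiff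
      (hA n).nullMeasurableSet (hB n).nullMeasurableSet) h1
  simpa using h2.add h

/-- If `S n` is asymptotically standard normal and `b n → 1` in probability, then `|S n| ≤ z b n`
has asymptotic probability `P(|N(0,1)| ≤ z)`. -/
lemma tendsto_measureReal_abs_le {S b : ℕ → Ω → ℝ} {z : ℝ}
    (hS : TendstoInDistribution S atTop (id : ℝ → ℝ) (fun _ => P) (gaussianReal 0 1))
    (hb : TendstoInMeasure P b atTop fun _ => 1) (hbm : ∀ n, Measurable (b n)) :
    Tendsto (fun n => P.real {ω | |S n ω| ≤ z * b n ω}) atTop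
      (𝓝 ((gaussianReal 0 1).real (Set.Icc (-z) z))) := by
  have : NullSingletonClass (gaussianReal 0 1) := nullSingletonClass_gaussianReal one_ne_zero
  have h := hS.continuous_comp_prodMk_of_tendstoInMeasure_const
    (g := fun x : ℝ × ℝ => |x.1| - z * x.2) (by fun_prop) hb fun n => (hbm n).aemeasurable
  -- The portmanteau theorem needs a null boundary; here the boundary event is `|N| = z`, at most
  -- two points.
  have hlim : (gaussianReal 0 1).map (fun x : ℝ => |id x| - z * 1) (frontier (Set.Iic 0)) = 0 := by
    rw [frontier_Iic, Measure.map_apply (by fun_prop) (measurableSet_singleton 0)]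
    refine measure_mono_null (t := {z, -z}) ?_ ((Set.toFinite _).measure_zero _)
    intro x hx
    simp only [Set.mem_preimage, id, mul_one, Set.mem_singleton_iff, sub_eq_zero] at hx
    exact eq_or_eq_neg_of_abs_eq hx
  have h2 := ProbabilityMeasure.tendsto_measure_of_null_frontier_of_tendsto' h.tendsto hlim
  simp only [ProbabilityMeasure.coe_mk] at h2
  have h3 := (ENNReal.tendsto_toReal (by finiteness)).comp h2
  convert! h3 using 1
  · ext n
    rw [Function.comp_apply, Measure.map_apply_of_aemeasurable (h.forall_aemeasurable n)
      measurableSet_Iic]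
    simp [Set.preimage, Measure.real]
  · rw [Measure.map_apply (by fun_prop) measurableSet_Iic]
    congr 3
    ext x
    simp [abs_le]

/-- With `t` the estimator, the summands depend on the whole sample and are not i.i.d.; expanding in
`t` leaves only i.i.d. averages. -/
lemma sampleMean_sq_sub (d q : ℕ → ℝ) (t : ℝ) (n : ℕ) :
    sampleMean (fun i => (d i - 2 * t * q i) ^ 2) n
      = sampleMean (fun i => d i ^ 2) n - 4 * t * sampleMean (fun i => d i * q i) n
        + 4 * t ^ 2 * sampleMean (fun i => q i ^ 2) n := by
  simp only [sampleMean, Finset.mul_sum, ← Finset.sum_sub_distrib, ← Finset.sum_add_distrib]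
  exact Finset.sum_congr rfl fun i _ => by ring

/-- The ratio estimator `mean d / (2 mean q)`. -/
def ratioHat (d q : ℕ → ℝ) (n : ℕ) : ℝ := sampleMean d n / (2 * sampleMean q n)

/-- The empirical second moment of `d - 2 t q` at `t = ratioHat`. -/
def ratioMoment (d q : ℕ → ℝ) (n : ℕ) : ℝ :=
  sampleMean (fun i => (d i - 2 * ratioHat d q n * q i) ^ 2) n

lemma measurable_sampleMean {f : ℕ → Ω → ℝ} (hf : ∀ i, Measurable (f i)) (n : ℕ) :
    Measurable (fun ω => sampleMean (fun i => f i ω) n) :=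
  (Finset.measurable_fun_sum _ fun i _ => hf i).const_mul _

variable {d q : E → ℝ} {τ : ℝ}

lemma measurable_ratioHat (hZ : ∀ i, Measurable (Zs i)) (hd : Measurable d) (hq : Measurable q)
    (n : ℕ) : Measurable (fun ω => ratioHat (fun i => d (Zs i ω)) (fun i => q (Zs i ω)) n) :=
  (measurable_sampleMean (fun i => hd.comp (hZ i)) n).div
    ((measurable_sampleMean (fun i => hq.comp (hZ i)) n).const_mul 2)

lemma measurable_ratioMoment (hZ : ∀ i, Measurable (Zs i)) (hd : Measurable d)
    (hq : Measurable q) (n : ℕ) :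
    Measurable (fun ω => ratioMoment (fun i => d (Zs i ω)) (fun i => q (Zs i ω)) n) :=
  measurable_sampleMean (fun i => ((hd.comp (hZ i)).sub
    (((measurable_ratioHat hZ hd hq n).const_mul 2).mul (hq.comp (hZ i)))).pow_const 2) n

lemma ae_tendsto_ratioMoment (hindep : iIndepFun Zs P) (hident : ∀ i, IdentDistrib (Zs i) Z P P)
    (hd : Measurable d) (hq : Measurable q) (hd2 : MemLp (fun ω => d (Z ω)) 2 P)
    (hq2 : MemLp (fun ω => q (Z ω)) 2 P) (hqpos : 0 < ∫ ω, q (Z ω) ∂P)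
    (hτ : ∫ ω, d (Z ω) ∂P = 2 * τ * ∫ ω, q (Z ω) ∂P) :
    ∀ᵐ ω ∂P, Tendsto (fun n => ratioMoment (fun i => d (Zs i ω)) (fun i => q (Zs i ω)) n) atTop
      (𝓝 (∫ ω, (d (Z ω) - 2 * τ * q (Z ω)) ^ 2 ∂P)) := by
  have hdq : Integrable (fun ω => d (Z ω) * q (Z ω)) P := hd2.integrable_mul hq2
  filter_upwards [ae_tendsto_sampleMean hindep hident hd (hd2.integrable (by norm_num)),
    ae_tendsto_sampleMean hindep hident hq (hq2.integrable (by norm_num)),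
    ae_tendsto_sampleMean hindep hident (hd.pow_const 2) hd2.integrable_sq,
    ae_tendsto_sampleMean hindep hident (f := fun x => d x * q x) (hd.mul hq) hdq,
    ae_tendsto_sampleMean hindep hident (hq.pow_const 2) hq2.integrable_sq] with ω h1 h2 h3 h4 h5
  have ht : Tendsto (fun n => ratioHat (fun i => d (Zs i ω)) (fun i => q (Zs i ω)) n) atTop
      (𝓝 τ) := by
    have := h1.div (h2.const_mul 2) (by positivity)
    rwa [hτ, show 2 * τ * (∫ ω, q (Z ω) ∂P) / (2 * ∫ ω, q (Z ω) ∂P) = τ by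
      field_simp] at this
  have := (h3.sub ((ht.const_mul 4).mul h4)).add (((ht.pow 2).const_mul 4).mul h5)
  simp only [ratioMoment, sampleMean_sq_sub]
  convert this using 2
  have h6 : Integrable (fun ω => d (Z ω) ^ 2 - 4 * τ * (d (Z ω) * q (Z ω))) P :=
    hd2.integrable_sq.sub (hdq.const_mul _)
  rw [← integral_const_mul, ← integral_const_mul,
    ← integral_sub hd2.integrable_sq (hdq.const_mul (4 * τ)),
    ← integral_add h6 (hq2.integrable_sq.const_mul _)]
  exact integral_congr_ae (ae_of_all _ fun ω => by simp only; ring)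

lemma tendstoInMeasure_ratio_variance (hZ : ∀ i, Measurable (Zs i)) (hindep : iIndepFun Zs P)
    (hident : ∀ i, IdentDistrib (Zs i) Z P P)
    (hd : Measurable d) (hq : Measurable q) (hd2 : MemLp (fun ω => d (Z ω)) 2 P)
    (hq2 : MemLp (fun ω => q (Z ω)) 2 P) (hqpos : 0 < ∫ ω, q (Z ω) ∂P)
    (hτ : ∫ ω, d (Z ω) ∂P = 2 * τ * ∫ ω, q (Z ω) ∂P) :
    TendstoInMeasure P
      (fun n ω => ratioMoment (fun i => d (Zs i ω)) (fun i => q (Zs i ω)) n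
        / (2 * sampleMean (fun i => q (Zs i ω)) n) ^ 2) atTop
      (fun _ => (∫ ω, (d (Z ω) - 2 * τ * q (Z ω)) ^ 2 ∂P) / (2 * ∫ ω, q (Z ω) ∂P) ^ 2) := by
  refine tendstoInMeasure_of_tendsto_ae (fun n => Measurable.aestronglyMeasurable ?_) ?_
  · exact (measurable_ratioMoment hZ hd hq n).div
      (((measurable_sampleMean (fun i => hq.comp (hZ i)) n).const_mul 2).pow_const 2)
  · filter_upwards [ae_tendsto_ratioMoment hindep hident hd hq hd2 hq2 hqpos hτ,
      ae_tendsto_sampleMean hindep hident hq (hq2.integrable (by norm_num))] with ω h1 h2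
    exact h1.div ((h2.const_mul 2).pow 2) (by positivity)

/-- The standardized score sum equals `(τ̂ - τ) √n a / √v` with `a = 2 · mean q > 0`, and the
standard error carries the same `1 / a`. The equivalence is exact and holds for any sign of `z`. -/
lemma mem_ratio_interval_iff (d q : ℕ → ℝ) {n : ℕ} {τ z v : ℝ} (hn : 0 < n) (hv : 0 < v)
    (hq : 0 < sampleMean q n) :
    τ ∈ Set.Icc
        (ratioHat d q n - z * √(ratioMoment d q n / (2 * sampleMean q n) ^ 2) / √(n : ℝ))
        (ratioHat d q n + z * √(ratioMoment d q n / (2 * sampleMean q n) ^ 2) / √(n : ℝ)) ↔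
      |(√(n : ℝ))⁻¹ * ∑ i ∈ Finset.range n, (d i - 2 * τ * q i) / √v|
        ≤ z * (√(ratioMoment d q n) / √v) := by
  have hn' : (0 : ℝ) < n := by exact_mod_cast hn
  have hs : 0 < √(n : ℝ) := Real.sqrt_pos.2 hn'
  have hsv : 0 < √v := Real.sqrt_pos.2 hv
  set a := 2 * sampleMean q n with ha
  have hapos : 0 < a := by positivity
  have hsum : (√(n : ℝ))⁻¹ * ∑ i ∈ Finset.range n, (d i - 2 * τ * q i) / √v
      = (ratioHat d q n - τ) * (√(n : ℝ) * a / √v) := by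
    have h1 : ∑ i ∈ Finset.range n, (d i - 2 * τ * q i)
        = n * (sampleMean d n - τ * a) := by
      rw [ha]
      simp only [sampleMean, Finset.sum_sub_distrib, ← Finset.mul_sum]
      field_simp
    have h2 : sampleMean d n = ratioHat d q n * a := by
      rw [ratioHat, ← ha, div_mul_cancel₀ _ hapos.ne']
    rw [← Finset.sum_div, h1, h2]
    field_simp
    rw [Real.sq_sqrt hn'.le]
  have hc : 0 < √(n : ℝ) * a / √v := by positivity
  rw [hsum, abs_mul, abs_of_pos hc, ← le_div_iff₀ hc, Real.sqrt_div' _ (sq_nonneg a),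
    Real.sqrt_sq hapos.le, abs_le]
  have he : z * (√(ratioMoment d q n) / √v) / (√(n : ℝ) * a / √v)
      = z * (√(ratioMoment d q n) / a) / √(n : ℝ) := by
    field_simp
  rw [he, Set.mem_Icc]
  constructor <;> rintro ⟨h1, h2⟩ <;> constructor <;> linarith

lemma measurableSet_mem_Icc {f g : Ω → ℝ} (hf : Measurable f) (hg : Measurable g) (c : ℝ) :
    MeasurableSet {ω | c ∈ Set.Icc (f ω) (g ω)} :=
  (measurableSet_le hf measurable_const).inter (measurableSet_le measurable_const hg)

lemma tendsto_ratio_coverage (hZ : ∀ i, Measurable (Zs i)) (hindep : iIndepFun Zs P)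
    (hident : ∀ i, IdentDistrib (Zs i) Z P P)
    (hd : Measurable d) (hq : Measurable q) (hd2 : MemLp (fun ω => d (Z ω)) 2 P)
    (hq2 : MemLp (fun ω => q (Z ω)) 2 P) (hqpos : 0 < ∫ ω, q (Z ω) ∂P)
    (hτ : ∫ ω, d (Z ω) ∂P = 2 * τ * ∫ ω, q (Z ω) ∂P)
    (hv : 0 < ∫ ω, (d (Z ω) - 2 * τ * q (Z ω)) ^ 2 ∂P) (z : ℝ) :
    Tendsto (fun n : ℕ => P.real {ω | τ ∈ Set.Icc
        (ratioHat (fun i => d (Zs i ω)) (fun i => q (Zs i ω)) n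
          - z * √(ratioMoment (fun i => d (Zs i ω)) (fun i => q (Zs i ω)) n
            / (2 * sampleMean (fun i => q (Zs i ω)) n) ^ 2) / √(n : ℝ))
        (ratioHat (fun i => d (Zs i ω)) (fun i => q (Zs i ω)) n
          + z * √(ratioMoment (fun i => d (Zs i ω)) (fun i => q (Zs i ω)) n
            / (2 * sampleMean (fun i => q (Zs i ω)) n) ^ 2) / √(n : ℝ))}) atTop
      (𝓝 ((gaussianReal 0 1).real (Set.Icc (-z) z))) := by
  have hf : Measurable (fun x => d x - 2 * τ * q x) := hd.sub (hq.const_mul _)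
  have h0 : ∫ ω, (d (Z ω) - 2 * τ * q (Z ω)) ∂P = 0 := by
    rw [integral_sub (hd2.integrable (by norm_num)) ((hq2.integrable (by norm_num)).const_mul _),
      integral_const_mul, hτ, sub_self]
  have hS := tendstoInDistribution_sum_div hindep hident hf h0 hv
  have hM := measurable_ratioMoment hZ hd hq
  have hH := measurable_ratioHat hZ hd hq
  have hA : ∀ n, Measurable fun ω => sampleMean (fun i => q (Zs i ω)) n :=
    measurable_sampleMean fun i => hq.comp (hZ i)
  set v := ∫ ω, (d (Z ω) - 2 * τ * q (Z ω)) ^ 2 ∂P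
  have hbm (n : ℕ) : Measurable
      (fun ω => √(ratioMoment (fun i => d (Zs i ω)) (fun i => q (Zs i ω)) n) / √v) :=
    (hM n).sqrt.div_const _
  have hb : TendstoInMeasure P
      (fun n ω => √(ratioMoment (fun i => d (Zs i ω)) (fun i => q (Zs i ω)) n) / √v) atTop
      (fun _ => 1) := by
    refine tendstoInMeasure_of_tendsto_ae (fun n => (hbm n).aestronglyMeasurable) ?_
    filter_upwards [ae_tendsto_ratioMoment hindep hident hd hq hd2 hq2 hqpos hτ] with ω h
    have := (h.sqrt).div_const √v
    rwa [div_self (Real.sqrt_pos.2 hv).ne'] at this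
  have hw (n : ℕ) : Measurable fun ω =>
      z * √(ratioMoment (fun i => d (Zs i ω)) (fun i => q (Zs i ω)) n
        / (2 * sampleMean (fun i => q (Zs i ω)) n) ^ 2) / √(n : ℝ) :=
    ((((hM n).div (((hA n).const_mul 2).pow_const 2)).sqrt).const_mul z).div_const _
  refine tendsto_measureReal_of_ae_eventually_iff (fun n => ?_) (fun n => ?_) ?_
    (tendsto_measureReal_abs_le hS hb hbm)
  · exact measurableSet_mem_Icc ((hH n).sub (hw n)) ((hH n).add (hw n)) τ
  · refine measurableSet_le (Measurable.abs ?_) ((hbm n).const_mul z)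
    exact (Finset.measurable_fun_sum _ fun i _ => (hf.comp (hZ i)).div_const _).const_mul _
  · filter_upwards [ae_tendsto_sampleMean hindep hident hq (hq2.integrable (by norm_num))]
      with ω h
    filter_upwards [h.eventually_const_lt hqpos, eventually_gt_atTop 0] with n hn hn0
    exact mem_ratio_interval_iff _ _ hn0 hv hn

end Ratio

end LatentGroup

end

theorem proposition3 {Ω 𝒳 : Type*} [MeasurableSpace Ω] [MeasurableSpace 𝒳]
    (P : Measure Ω) [IsProbabilityMeasure P]
    (Y : Ω → ℝ) (X : Ω → 𝒳) (p G : Ω → ℝ) (τ : ℝ) (m r : 𝒳 → ℝ)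
    (Ys : ℕ → Ω → ℝ) (Xs : ℕ → Ω → 𝒳) (ps : ℕ → Ω → ℝ)
    (hset : LatentGroup.IsSetting Y X p G)
    (hm : LatentGroup.IsCondMeanFun P Y X m)
    (hr : LatentGroup.IsCondMeanFun P p X r)
    (hmean : LatentGroup.StructuralMean P Y X p G τ)
    (hcal : LatentGroup.Calibrated P X p G)
    (hvar : 0 < LatentGroup.residualVar P X p r)
    (hY4 : Integrable (fun ω => Y ω ^ 4) P)
    (hp4 : Integrable (fun ω => p ω ^ 4) P)
    (hsample : LatentGroup.IsIIDSample P Y X p Ys Xs ps) :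
    Integrable (fun ω => LatentGroup.score m r τ (Y ω) (X ω) (p ω) ^ 2) P ∧
    TendstoInMeasure P (LatentGroup.sigmaSqHat m r Ys Xs ps) atTop
      (fun _ => LatentGroup.sigmaSq P Y X p m r τ) ∧
    (0 < LatentGroup.sigmaSq P Y X p m r τ →
      ∀ α : ℝ, 0 < α → α < 1 →
        Tendsto (fun n : ℕ => P.real {ω | τ ∈ LatentGroup.waldInterval m r Ys Xs ps α n ω})
          atTop (𝓝 (1 - α))) := by
  have hd : Measurable fun x : ℝ × 𝒳 × ℝ => (2 * x.2.2 - 1) * (x.1 - m x.2.1) := by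
    have := hm.measurable
    fun_prop
  have hq : Measurable fun x : ℝ × 𝒳 × ℝ => (x.2.2 - r x.2.1) ^ 2 := by
    have := hr.measurable
    fun_prop
  have hZ (i : ℕ) : Measurable fun ω => (Ys i ω, Xs i ω, ps i ω) :=
    (hsample.measurable_Y i).prodMk ((hsample.measurable_X i).prodMk (hsample.measurable_p i))
  have hd2 : MemLp (fun ω => (2 * p ω - 1) * (Y ω - m (X ω))) 2 P :=
    (LatentGroup.memLp_numerator hset hm hY4).mono_exponent (by norm_num)
  have hq2 : MemLp (fun ω => (p ω - r (X ω)) ^ 2) 2 P :=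
    LatentGroup.memLp_denominator hset hr 2
  have hτ := LatentGroup.integral_numerator hset hm hr hmean hcal hY4
  have hvar' : 0 < ∫ ω, (p ω - r (X ω)) ^ 2 ∂P := hvar
  have hσhat : LatentGroup.sigmaSqHat m r Ys Xs ps = fun n ω =>
      LatentGroup.ratioMoment (fun i => (2 * ps i ω - 1) * (Ys i ω - m (Xs i ω)))
        (fun i => (ps i ω - r (Xs i ω)) ^ 2) n
        / (2 * LatentGroup.sampleMean (fun i => (ps i ω - r (Xs i ω)) ^ 2) n) ^ 2 := rfl
  have hτhat : LatentGroup.tauHat m r Ys Xs ps = fun n ω =>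
      LatentGroup.ratioHat (fun i => (2 * ps i ω - 1) * (Ys i ω - m (Xs i ω)))
        (fun i => (ps i ω - r (Xs i ω)) ^ 2) n := rfl
  refine ⟨(hd2.sub (hq2.const_mul (2 * τ))).integrable_sq, ?_, fun hσ α h0 h1 => ?_⟩
  · have hcons := LatentGroup.tendstoInMeasure_ratio_variance (Z := fun ω => (Y ω, X ω, p ω))
      hZ hsample.indep hsample.ident hd hq hd2 hq2 hvar' hτ
    rw [hσhat]
    exact hcons
  · have hv : 0 < ∫ ω, LatentGroup.score m r τ (Y ω) (X ω) (p ω) ^ 2 ∂P :=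
      (div_pos_iff_of_pos_right (pow_pos (mul_pos two_pos hvar) 2)).1 hσ
    have hcov := LatentGroup.tendsto_ratio_coverage (Z := fun ω => (Y ω, X ω, p ω))
      hZ hsample.indep hsample.ident hd hq hd2 hq2 hvar' hτ hv
      (LatentGroup.normalQuantile (1 - α / 2))
    rw [LatentGroup.gaussianReal_Icc_normalQuantile h0 h1] at hcov
    simp only [LatentGroup.waldInterval, hσhat, hτhat]
    exact hcov
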